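/- **Conventions.** Let $\mathbb D$ be an infinite set of data values and $\Gamma$ a finite alphabet (for instance $\Gamma=\Sigma^{\pm}$). A *data path* is $\alpha=d_0a_1d_1\dots a_nd_n$ with $n\ge 0$, $d_i\in\mathbb D$, $a_i\in\Gamma$; $d_i$ is at position $2i$. *Position terms* are given by $t::=\mathrm{cur}\mid \mathrm{suc}(t)\mid\mathrm{pred}(t)\mid\mathrm{suc}_A(t)\mid\mathrm{pred}_A(t)$ with $\emptyset\ne A\subseteq\Gamma$. The value $t_\alpha[2i]$ is a position of a data value or $\bot$: $\mathrm{cur}_\alpha[2i]=2i$, and if $t_\alpha[2i]=2m$, then $\mathrm{suc}(t)_\alpha[2i]=2(m+1)$ if $m<n$; $\mathrm{pred}(t)_\alpha[2i]=2(m-1)$ if $m>0$; $\mathrm{suc}_A(t)_\alpha[2i]=2j$ for the least $j$ with $m<j\le n$ and $a_j\in A$; $\mathrm{pred}_A(t)_\alpha[2i]=2(j-1)$ for the greatest $j$ with $1\le j\le m$ and $a_j\in A$; in all other cases the value is $\bot$. *Rigid data constraints* are the positive Boolean combinations of atoms $t_1\sim t_2$ and $t_1\nsim t_2$; $(\alpha,2i)\models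 t_1\sim t_2$ iff $t_1,t_2$ are both defined at $2i$ and denote positions with equal data values, and $t_1\nsim t_2$ is the negation of $t_1\sim t_2$. An *NRRA* is $\mathcal A=(Q,\delta,I,F)$ with $Q=Q_d\uplus Q_w$ finite, $I\subseteq Q_d$, $F\subseteq Q_w$, and $\delta$ a finite set of word transitions in $Q_w\times\Gamma\times Q_d$ and data transitions $(q,c,q')$ with $q\in Q_d$, $q'\in Q_w$ and $c$ a rigid data constraint. It accepts $\alpha$ iff there are states $q_0\in I,q_1,\dots,q_{2n},q_{2n+1}\in F$ and constraints $c_0,\dots,c_n$ with $(q_{2i},c_i,q_{2i+1})\in\delta$ and $(\alpha,2i)\models c_i$ for $0\le i\le n$, and $(q_{2i-1},a_i,q_{2i})\in\delta$ for $1\le i\le n$. Let $\mathcal T_{\mathcal A}$ be the smallest set of position terms that contains all terms compared in constraints of $\mathcal A$ and that with $t$ contains $t'$ and $t[t'\backslash\mathrm{cur}]$ ($t$ with $t'$ replaced by $\mathrm{cur}$) for every subterm $t'$ of $t$; it is finite. A *$k$-register constraint* is a positive Boolean combination of atoms $r_i\sim r_j$, $r_i\nsim r_j$ with $0\le i,j\le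 k$, $i\neq j$, where $r_0$ stands for the current data value. For register contents $\theta\in(\mathbb D\cup\{\bot\})^{k}$ and a current data value $d$, $r_i\sim r_j$ holds iff both are nonempty with equal content, and $r_i\nsim r_j$ is its negation. An *NRAG* is $\mathcal B=(Q',k,\delta',I',F')$ with $Q'=Q'_d\uplus Q'_w$ finite, $I'\subseteq Q'_d$, $F'\subseteq Q'_w$, and $\delta'$ a finite set of word transitions in $Q'_w\times\Gamma\times Q'_d$ and data transitions $(q,c,q',X,Y,c')$ with $q\in Q'_d$, $q'\in Q'_w$, $c$ a $k$-register constraint, $X,Y\subseteq\{1,\dots,k\}$ disjoint, and $c'$ a $2k$-register constraint in which $r_{k+i}$ does not occur for $i\notin Y$. Starting in a state of $I'$ with all registers empty, $\mathcal B$ reads $\alpha$ from left to right. Word transitions leave the registers unchanged. On a data value $d$ with registers $\theta$, a data transition $(q,c,q',X,Y,c')$ can be taken if $(\theta,d)\models c$; values $d'_i\in\mathbb D$ $(i\in Y)$ are then guessed such that $c'$ holds for $d$ and $\theta$ extended by the content $d'_i$ of $r_{k+i}$ for $i\in Y$; the new content of $r_i$ is $d$ for $i\in X$, $d'_i$ for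 $i\in Y$, and unchanged otherwise. $\mathcal B$ accepts $\alpha$ iff it can reach a state of $F'$ after reading all of $\alpha$. **Theorem.** There are polynomials $p,q,r$ with natural number coefficients such that for every finite alphabet $\Gamma$ and every NRRA $\mathcal A=(Q,\delta,I,F)$ over $\Gamma$ there is an NRAG $\mathcal B=(Q',k,\delta',I',F')$ over $\Gamma$ that accepts exactly the same data paths as $\mathcal A$, for every infinite set $\mathbb D$ of data values, and satisfies $$|Q'|\le p(|Q|)\cdot 2^{q(|\mathcal T_{\mathcal A}|)}\qquad\text{and}\qquad k\le r(|\mathcal T_{\mathcal A}|).$$ -/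

import Mathlib

namespace RegisterAutomata

/-- A data path `d₀ a₁ d₁ … aₙ dₙ` over the alphabet `Γ` with data values in `D`.
`data i` is `dᵢ` (the symbol at position `2i`), and `letter i` is `aᵢ₊₁` (the symbol at
position `2i+1`), the word symbol between `data i` and `data (i+1)`. -/
structure DataPath (D Γ : Type*) where
  length : ℕ
  data : Fin (length + 1) → D
  letter : Fin length → Γ

/-! ### Position terms and rigid data constraints -/

/-- Position terms over the alphabet `Γ`; the subscripts `A` are nonempty sets of letters. -/
inductive PosTerm (Γ : Type*) where
  | cur : PosTerm Γ
  | suc (t : PosTerm Γ) : PosTerm Γ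
  | pred (t : PosTerm Γ) : PosTerm Γ
  | sucIn (A : Set Γ) (hA : A.Nonempty) (t : PosTerm Γ) : PosTerm Γ
  | predIn (A : Set Γ) (hA : A.Nonempty) (t : PosTerm Γ) : PosTerm Γ

namespace PosTerm

variable {Γ : Type*}

/-- The set of subterms of a position term (the term itself included). -/
def sub : PosTerm Γ → Set (PosTerm Γ)
  | cur => {cur}
  | suc t => {suc t} ∪ t.sub
  | pred t => {pred t} ∪ t.sub
  | sucIn A hA t => {sucIn A hA t} ∪ t.sub
  | predIn A hA t => {predIn A hA t} ∪ t.sub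

open Classical in
/-- `t.replace s u` is the term `t[s \ u]`, obtained from `t` by replacing its subterm `s`
with `u`. -/
noncomputable def replace (t s u : PosTerm Γ) : PosTerm Γ :=
  if t = s then u else
    match t with
    | cur => cur
    | suc t' => suc (t'.replace s u)
    | pred t' => pred (t'.replace s u)
    | sucIn A hA t' => sucIn A hA (t'.replace s u)
    | predIn A hA t' => predIn A hA (t'.replace s u)

/-- The number of function symbols of a position term. -/
def depth : PosTerm Γ → ℕ
  | cur => 0
  | suc t => t.depth + 1
  | pred t => t.depth + 1
  | sucIn _ _ t => t.depth + 1
  | predIn _ _ t => t.depth + 1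

theorem depth_le_of_mem_sub {t t' : PosTerm Γ} (h : t' ∈ t.sub) : t'.depth ≤ t.depth := by
  induction t with
  | cur => rw [Set.mem_singleton_iff.1 h]
  | suc t ih | pred t ih | sucIn A hA t ih | predIn A hA t ih =>
    rcases h with h | h
    · rw [Set.mem_singleton_iff.1 h]
    · exact (ih h).trans (Nat.le_succ _)

theorem depth_replace_le (t s : PosTerm Γ) : (t.replace s cur).depth ≤ t.depth := by
  induction t with
  | cur => unfold replace; split_ifs <;> simp [depth]
  | suc t ih | pred t ih | sucIn A hA t ih | predIn A hA t ih =>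
    unfold replace; split_ifs <;> simp [depth, ih]

theorem finite_depth_le [Finite Γ] (n : ℕ) : {t : PosTerm Γ | t.depth ≤ n}.Finite := by
  induction n with
  | zero =>
    refine (Set.finite_singleton cur).subset fun t ht => ?_
    cases t <;> simp_all [depth]
  | succ n ih =>
    have h1 := ih.image suc
    have h2 := ih.image pred
    have h3 := ((Set.finite_univ (α := {A : Set Γ // A.Nonempty})).prod ih).image
      fun x => sucIn x.1.1 x.1.2 x.2
    have h4 := ((Set.finite_univ (α := {A : Set Γ // A.Nonempty})).prod ih).image
      fun x => predIn x.1.1 x.1.2 x.2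
    refine ((((h1.union h2).union h3).union h4).insert cur).subset fun t ht => ?_
    cases t with
    | cur => exact Or.inl rfl
    | suc t => exact Or.inr (Or.inl (Or.inl (Or.inl ⟨t, Nat.le_of_succ_le_succ ht, rfl⟩)))
    | pred t => exact Or.inr (Or.inl (Or.inl (Or.inr ⟨t, Nat.le_of_succ_le_succ ht, rfl⟩)))
    | sucIn A hA t =>
      exact Or.inr (Or.inl (Or.inr ⟨(⟨A, hA⟩, t), ⟨trivial, Nat.le_of_succ_le_succ ht⟩, rfl⟩))
    | predIn A hA t =>
      exact Or.inr (Or.inr ⟨(⟨A, hA⟩, t), ⟨trivial, Nat.le_of_succ_le_succ ht⟩, rfl⟩)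

/-- `t.Denotes α i j` says that `t_α[2i] = 2j`. The value `t_α[2i]` is `⊥` exactly if there is no
such `j`; there is at most one by `Denotes.unique`.

In the clause for `sucIn`, the letter of index `l` is `a_{l+1}`, so `l.succ` is the index of the
data value immediately after it, and `m ≤ l.castSucc` says that it comes after the data value of
index `m`; in the clause for `predIn`, `l.castSucc` is the index of the data value immediately
before that letter, and `l.succ ≤ m` says that it comes before the data value of index `m`. -/
def Denotes {D : Type*} (α : DataPath D Γ) :
    PosTerm Γ → Fin (α.length + 1) → Fin (α.length + 1) → Prop
  | cur, i, j => j = i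
  | suc t, i, j => ∃ m, t.Denotes α i m ∧ (j : ℕ) = m + 1
  | pred t, i, j => ∃ m, t.Denotes α i m ∧ (j : ℕ) + 1 = m
  | sucIn A _ t, i, j => ∃ m, t.Denotes α i m ∧
      ∃ l : Fin α.length, j = l.succ ∧ m ≤ l.castSucc ∧ α.letter l ∈ A ∧
        ∀ l' : Fin α.length, m ≤ l'.castSucc → l' < l → α.letter l' ∉ A
  | predIn A _ t, i, j => ∃ m, t.Denotes α i m ∧
      ∃ l : Fin α.length, j = l.castSucc ∧ l.succ ≤ m ∧ α.letter l ∈ A ∧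
        ∀ l' : Fin α.length, l'.succ ≤ m → l < l' → α.letter l' ∉ A

theorem Denotes.unique {D : Type*} {α : DataPath D Γ} {t : PosTerm Γ}
    {i j j' : Fin (α.length + 1)} (h : t.Denotes α i j) (h' : t.Denotes α i j') : j = j' := by
  induction t generalizing j j' with
  | cur => exact Eq.trans h (Eq.symm h')
  | suc t ih =>
    obtain ⟨m, hm, e⟩ := h
    obtain ⟨m', hm', e'⟩ := h'
    obtain rfl := ih hm hm'
    exact Fin.ext (by omega)
  | pred t ih =>
    obtain ⟨m, hm, e⟩ := h
    obtain ⟨m', hm', e'⟩ := h'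
    obtain rfl := ih hm hm'
    exact Fin.ext (by omega)
  | sucIn A hA t ih =>
    obtain ⟨m, hm, l, rfl, h1, h2, h3⟩ := h
    obtain ⟨m', hm', l', rfl, h1', h2', h3'⟩ := h'
    obtain rfl := ih hm hm'
    rcases lt_trichotomy l l' with hl | hl | hl
    · exact absurd h2 (h3' l h1 hl)
    · rw [hl]
    · exact absurd h2' (h3 l' h1' hl)
  | predIn A hA t ih =>
    obtain ⟨m, hm, l, rfl, h1, h2, h3⟩ := h
    obtain ⟨m', hm', l', rfl, h1', h2', h3'⟩ := h'
    obtain rfl := ih hm hm'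
    rcases lt_trichotomy l l' with hl | hl | hl
    · exact absurd h2' (h3 l' h1' hl)
    · rw [hl]
    · exact absurd h2 (h3' l h1 hl)

end PosTerm

/-- Rigid data constraints over `Γ`: positive Boolean combinations of `t₁ ∼ t₂` and `t₁ ≁ t₂`. -/
inductive RigidConstraint (Γ : Type*) where
  | eq (t₁ t₂ : PosTerm Γ) : RigidConstraint Γ
  | ne (t₁ t₂ : PosTerm Γ) : RigidConstraint Γ
  | or (c₁ c₂ : RigidConstraint Γ) : RigidConstraint Γ
  | and (c₁ c₂ : RigidConstraint Γ) : RigidConstraint Γ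

namespace RigidConstraint

variable {Γ : Type*}

/-- `c.Sat α i` says `(α, 2i) ⊨ c`. The constraint `t₁ ∼ t₂` holds if both terms are defined and
denote positions with the same data value, and `t₁ ≁ t₂` is its negation. -/
def Sat {D : Type*} (α : DataPath D Γ) (i : Fin (α.length + 1)) : RigidConstraint Γ → Prop
  | eq t₁ t₂ => ∃ j₁ j₂, t₁.Denotes α i j₁ ∧ t₂.Denotes α i j₂ ∧ α.data j₁ = α.data j₂
  | ne t₁ t₂ => ¬ ∃ j₁ j₂, t₁.Denotes α i j₁ ∧ t₂.Denotes α i j₂ ∧ α.data j₁ = α.data j₂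
  | or c₁ c₂ => c₁.Sat α i ∨ c₂.Sat α i
  | and c₁ c₂ => c₁.Sat α i ∧ c₂.Sat α i

/-- The position terms that are the two sides of an atomic constraint occurring in `c`. -/
def sides : RigidConstraint Γ → Set (PosTerm Γ)
  | eq t₁ t₂ => {t₁, t₂}
  | ne t₁ t₂ => {t₁, t₂}
  | or c₁ c₂ => c₁.sides ∪ c₂.sides
  | and c₁ c₂ => c₁.sides ∪ c₂.sides

end RigidConstraint

/-! ### Nondeterministic rigid register automata -/

/-- A nondeterministic rigid register automaton over `Γ` with data states `Qd` and word
states `Qw`; its set of states is the disjoint union of the two. -/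
structure NRRA (Γ Qd Qw : Type*) where
  wordTrans : Set (Qw × Γ × Qd)
  dataTrans : Set (Qd × RigidConstraint Γ × Qw)
  dataTrans_finite : dataTrans.Finite
  init : Set Qd
  final : Set Qw

namespace NRRA

variable {Γ Qd Qw : Type*}

/-- A run `q₀ c₀ q₁ a₁ q₂ … q₂ₙ cₙ q₂ₙ₊₁` over a data path, where `dataState i` is `q₂ᵢ`,
`constraint i` is `cᵢ` and `wordState i` is `q₂ᵢ₊₁`. -/
structure Run {D : Type*} (𝒜 : NRRA Γ Qd Qw) (α : DataPath D Γ) where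
  dataState : Fin (α.length + 1) → Qd
  constraint : Fin (α.length + 1) → RigidConstraint Γ
  wordState : Fin (α.length + 1) → Qw
  start : dataState 0 ∈ 𝒜.init
  data_step : ∀ i, (dataState i, constraint i, wordState i) ∈ 𝒜.dataTrans
  sat : ∀ i, (constraint i).Sat α i
  word_step : ∀ i : Fin α.length,
    (wordState i.castSucc, α.letter i, dataState i.succ) ∈ 𝒜.wordTrans

/-- The set of data paths (with data values in `D`) that have an accepting run. -/
def language (D : Type*) (𝒜 : NRRA Γ Qd Qw) : Set (DataPath D Γ) :=
  {α | ∃ ρ : 𝒜.Run α, ρ.wordState (Fin.last α.length) ∈ 𝒜.final}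

/-- The smallest set of position terms that contains all the terms compared in some constraint of
the automaton and, together with `t`, contains `t'` and `t[t' \ cur]` for every subterm `t'`
of `t`. -/
inductive IsTerm (𝒜 : NRRA Γ Qd Qw) : PosTerm Γ → Prop
  | occurs {q c q' t} (h : (q, c, q') ∈ 𝒜.dataTrans) (ht : t ∈ c.sides) : IsTerm 𝒜 t
  | sub {t t'} (h : IsTerm 𝒜 t) (ht : t' ∈ t.sub) : IsTerm 𝒜 t'
  | replace {t t'} (h : IsTerm 𝒜 t) (ht : t' ∈ t.sub) : IsTerm 𝒜 (t.replace t' PosTerm.cur)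

/-- The set `𝒯_𝒜` of position terms of the automaton. It is finite by `terms_finite`. -/
def terms (𝒜 : NRRA Γ Qd Qw) : Set (PosTerm Γ) := {t | 𝒜.IsTerm t}

theorem terms_finite [Finite Γ] (𝒜 : NRRA Γ Qd Qw) : 𝒜.terms.Finite := by
  have hs : ∀ c : RigidConstraint Γ, c.sides.Finite := by
    intro c
    induction c with
    | eq t₁ t₂ => exact (Set.finite_singleton t₂).insert t₁
    | ne t₁ t₂ => exact (Set.finite_singleton t₂).insert t₁
    | or c₁ c₂ h₁ h₂ => exact h₁.union h₂
    | and c₁ c₂ h₁ h₂ => exact h₁.union h₂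
  have hfin : (⋃ τ ∈ 𝒜.dataTrans, τ.2.1.sides).Finite :=
    𝒜.dataTrans_finite.biUnion fun τ _ => hs τ.2.1
  obtain ⟨n, hn⟩ := (hfin.image PosTerm.depth).bddAbove
  refine (PosTerm.finite_depth_le n).subset fun t ht => ?_
  induction ht with
  | @occurs q c q' t h ht =>
    exact hn ⟨t, Set.mem_biUnion (x := (q, c, q')) h ht, rfl⟩
  | sub h ht ih => exact (PosTerm.depth_le_of_mem_sub ht).trans ih
  | replace h ht ih => exact (PosTerm.depth_replace_le _ _).trans ih

end NRRA

/-! ### Register automata with nondeterministic guessing -/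

/-- `k`-register data constraints. The registers `r₁, …, r_k` have the indices `1, …, k`, and the
index `0` stands for the current data value. -/
inductive RegConstraint (k : ℕ) where
  | eq (i j : Fin (k + 1)) (h : i ≠ j) : RegConstraint k
  | ne (i j : Fin (k + 1)) (h : i ≠ j) : RegConstraint k
  | or (c₁ c₂ : RegConstraint k) : RegConstraint k
  | and (c₁ c₂ : RegConstraint k) : RegConstraint k

namespace RegConstraint

variable {k : ℕ}

/-- `c.Sat θ d` says `(θ, d) ⊨ c`, where `θ` is the content of the registers `r₁, …, r_k` (`none` for
an empty register) and `d` is the current data value. The constraint `rᵢ ∼ rⱼ` holds if both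
are nonempty and have the same content, and `rᵢ ≁ rⱼ` is its negation. -/
def Sat {D : Type*} (θ : Fin k → Option D) (d : D) : RegConstraint k → Prop
  | eq i j _ => ∃ x : D, (Fin.cons (some d) θ : Fin (k + 1) → Option D) i = some x ∧
      (Fin.cons (some d) θ : Fin (k + 1) → Option D) j = some x
  | ne i j _ => ¬ ∃ x : D, (Fin.cons (some d) θ : Fin (k + 1) → Option D) i = some x ∧
      (Fin.cons (some d) θ : Fin (k + 1) → Option D) j = some x
  | or c₁ c₂ => c₁.Sat θ d ∨ c₂.Sat θ d
  | and c₁ c₂ => c₁.Sat θ d ∧ c₂.Sat θ d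

/-- The set of (indices of) registers that occur in a constraint. -/
def registers : RegConstraint k → Set (Fin (k + 1))
  | eq i j _ => {i, j}
  | ne i j _ => {i, j}
  | or c₁ c₂ => c₁.registers ∪ c₂.registers
  | and c₁ c₂ => c₁.registers ∪ c₂.registers

end RegConstraint

/-- A data transition `(q, c, q', X, Y, c')`: test `c`, store the current data value in the
registers of `X`, and guess new contents for the registers of `Y` subject to `c'`. -/
structure GuessTransition (Qd Qw : Type*) (k : ℕ) where
  source : Qd
  test : RegConstraint k
  target : Qw
  store : Set (Fin k)
  guess : Set (Fin k)
  guessTest : RegConstraint (k + k)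

/-- A nondeterministic register data path automaton with guessing over `Γ`, with `k` registers,
data states `Qd` and word states `Qw`. The register `r_{i+1}` is represented by `i : Fin k`; in
the constraint `c'` its guessed new content `r_{k+i+1}` has the index `(Fin.natAdd k i).succ`. -/
structure NRAG (Γ Qd Qw : Type*) (k : ℕ) where
  wordTrans : Set (Qw × Γ × Qd)
  dataTrans : Set (GuessTransition Qd Qw k)
  dataTrans_finite : dataTrans.Finite
  disjoint : ∀ τ ∈ dataTrans, Disjoint τ.store τ.guess
  guessTest_registers : ∀ τ ∈ dataTrans, ∀ i ∉ τ.guess,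
    (Fin.natAdd k i).succ ∉ τ.guessTest.registers
  init : Set Qd
  final : Set Qw

namespace NRAG

variable {Γ Qd Qw : Type*} {k : ℕ}

/-- `Update τ θ d θ'`: reading the data value `d`, the transition `τ = (q, c, q', X, Y, c')` is
enabled at the register content `θ` and may change it to `θ'`. Here `g i` is the value guessed for
the register `i ∈ Y`; for `i ∉ Y` it is irrelevant, as then `r_{k+i}` does not occur in `c'`. -/
def Update {D : Type*} (τ : GuessTransition Qd Qw k) (θ : Fin k → Option D) (d : D)
    (θ' : Fin k → Option D) : Prop :=
  τ.test.Sat θ d ∧ ∃ g : Fin k → D,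
    τ.guessTest.Sat (Fin.append θ fun i => some (g i)) d ∧
    (∀ i ∈ τ.store, θ' i = some d) ∧
    (∀ i ∈ τ.guess, θ' i = some (g i)) ∧
    (∀ i, i ∉ τ.store → i ∉ τ.guess → θ' i = θ i)

/-- A configuration `(q, j, θ)`: a state, a position of the data path, and a register content. -/
structure Config (D Qd Qw : Type*) (k : ℕ) where
  state : Qd ⊕ Qw
  pos : ℕ
  reg : Fin k → Option D

/-- The successor relation between configurations over the data path `α`. -/
inductive Step {D : Type*} (ℬ : NRAG Γ Qd Qw k) (α : DataPath D Γ) :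
    Config D Qd Qw k → Config D Qd Qw k → Prop
  | word (i : Fin α.length) {q : Qw} {q' : Qd} (θ : Fin k → Option D)
      (h : (q, α.letter i, q') ∈ ℬ.wordTrans) :
      Step ℬ α ⟨Sum.inr q, 2 * i + 1, θ⟩ ⟨Sum.inl q', 2 * i + 2, θ⟩
  | data (i : Fin (α.length + 1)) {τ : GuessTransition Qd Qw k} {θ θ' : Fin k → Option D}
      (hτ : τ ∈ ℬ.dataTrans) (h : Update τ θ (α.data i) θ') :
      Step ℬ α ⟨Sum.inl τ.source, 2 * i, θ⟩ ⟨Sum.inr τ.target, 2 * i + 1, θ'⟩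

/-- The set of accepted data paths with data values in `D`; initially all registers are empty. -/
def language (D : Type*) (ℬ : NRAG Γ Qd Qw k) : Set (DataPath D Γ) :=
  {α | ∃ q ∈ ℬ.init, ∃ q' ∈ ℬ.final, ∃ θ : Fin k → Option D,
    Relation.ReflTransGen (ℬ.Step α)
      ⟨Sum.inl q, 0, fun _ => none⟩ ⟨Sum.inr q', 2 * α.length + 1, θ⟩}

end NRAG

end RegisterAutomata

open RegisterAutomata

/-!
Write `t[i]` for the value of a position term at the data value of index `i`. The innermost
function symbol of `t` decides how `t[i]` relates to the neighbouring data values: if it is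
`suc_A`, `s = t[suc_A(cur) \ cur]`, and the letter between the data values `i` and `i + 1`
is `a`, then `t[i] = s[i + 1]` if `a ∈ A`, and `t[i] = t[i + 1]` otherwise. Symmetrically,
`t[i + 1]` is `s[i]` or `t[i]` if the innermost symbol is `pred_A`; and `suc`, `pred` behave as
`suc_Γ`, `pred_Γ`. The relation `Link` collects these rules, and `DataPath.value_link` proves them.
Moreover, terms with innermost `suc_A` are undefined at the last data value, and those with
innermost `pred_A` at the first one. Together with `cur[i] = dᵢ`, these local rules determine all
the values (`DataPath.eq_value_of_local`), by induction on the number of function symbols and,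
inside, on the distance to the end of the path that the innermost symbol points to.

Hence an automaton with guessing that has one register per term can simulate `𝒜`: at each data
value it guesses the values of all the terms anew, together with the set of the terms that are
defined, and checks the local rules against the previous register contents as well as a constraint
of `𝒜` against the new ones. Besides the state of `𝒜` it remembers, in a word state, the set of
defined terms, and in a data state, what the local rules then demand across the letter just read
(`Demand`): a set of terms and a set of pairs of terms. So there are at most
`|Q| * 2 ^ (k + k ^ 2)` states for `k` terms, independently of the size of `Γ`.
-/

namespace RegisterAutomata

/-! ### Values of position terms -/

open Classical in
/-- The data value at the position denoted by `t` at `2i`, and `none` if `t` is undefined there. -/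
noncomputable def DataPath.value {D Γ : Type*} (α : DataPath D Γ) (t : PosTerm Γ)
    (i : Fin (α.length + 1)) : Option D :=
  if h : ∃ j, t.Denotes α i j then some (α.data h.choose) else none

section Value

variable {D Γ : Type*} {α : DataPath D Γ} {t u : PosTerm Γ} {i i' j : Fin (α.length + 1)}

theorem DataPath.value_of_denotes (h : t.Denotes α i j) : α.value t i = some (α.data j) := by
  have h' : ∃ j, t.Denotes α i j := ⟨j, h⟩
  rw [DataPath.value, dif_pos h', h'.choose_spec.unique h]

theorem DataPath.value_eq_none (h : ∀ j, ¬ t.Denotes α i j) : α.value t i = none :=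
  dif_neg fun ⟨j, hj⟩ => h j hj

theorem DataPath.value_eq_some {x : D} :
    α.value t i = some x ↔ ∃ j, t.Denotes α i j ∧ α.data j = x := by
  constructor
  · intro h
    by_cases h' : ∃ j, t.Denotes α i j
    · obtain ⟨j, hj⟩ := h'
      exact ⟨j, hj, by simpa [value_of_denotes hj] using h⟩
    · rw [value_eq_none (by simpa using h')] at h
      simp at h
  · rintro ⟨j, hj, rfl⟩
    exact value_of_denotes hj

theorem DataPath.value_congr (h : ∀ j, t.Denotes α i j ↔ u.Denotes α i' j) :
    α.value t i = α.value u i' :=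
  Option.ext fun x => by simp only [value_eq_some, h]

end Value

/-- Truth of a rigid data constraint under an arbitrary assignment of (optional) data values to
position terms. -/
def RigidConstraint.Eval {D Γ : Type*} (V : PosTerm Γ → Option D) : RigidConstraint Γ → Prop
  | eq t₁ t₂ => ∃ x, V t₁ = some x ∧ V t₂ = some x
  | ne t₁ t₂ => ¬ ∃ x, V t₁ = some x ∧ V t₂ = some x
  | or c₁ c₂ => c₁.Eval V ∨ c₂.Eval V
  | and c₁ c₂ => c₁.Eval V ∧ c₂.Eval V

theorem RigidConstraint.sat_iff_eval {D Γ : Type*} {α : DataPath D Γ} {i : Fin (α.length + 1)}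
    (c : RigidConstraint Γ) : c.Sat α i ↔ c.Eval fun t => α.value t i := by
  have key : ∀ t₁ t₂ : PosTerm Γ,
      (∃ j₁ j₂, t₁.Denotes α i j₁ ∧ t₂.Denotes α i j₂ ∧ α.data j₁ = α.data j₂) ↔
        ∃ x, α.value t₁ i = some x ∧ α.value t₂ i = some x := by
    intro t₁ t₂
    simp only [DataPath.value_eq_some]
    constructor
    · rintro ⟨j₁, j₂, h₁, h₂, e⟩
      exact ⟨_, ⟨j₁, h₁, e⟩, j₂, h₂, rfl⟩
    · rintro ⟨x, ⟨j₁, h₁, rfl⟩, j₂, h₂, e⟩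
      exact ⟨j₁, j₂, h₁, h₂, e.symm⟩
  induction c with
  | eq t₁ t₂ => exact key t₁ t₂
  | ne t₁ t₂ => exact not_congr (key t₁ t₂)
  | or c₁ c₂ h₁ h₂ => exact or_congr h₁ h₂
  | and c₁ c₂ h₁ h₂ => exact and_congr h₁ h₂

theorem RigidConstraint.eval_congr {D Γ : Type*} {V W : PosTerm Γ → Option D}
    {c : RigidConstraint Γ} (h : ∀ t ∈ c.sides, V t = W t) : c.Eval V ↔ c.Eval W := by
  induction c with
  | eq t₁ t₂ | ne t₁ t₂ => simp [Eval, h t₁ (by simp [sides]), h t₂ (by simp [sides])]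
  | or c₁ c₂ h₁ h₂ =>
    exact or_congr (h₁ fun t ht => h t (Or.inl ht)) (h₂ fun t ht => h t (Or.inr ht))
  | and c₁ c₂ h₁ h₂ =>
    exact and_congr (h₁ fun t ht => h t (Or.inl ht)) (h₂ fun t ht => h t (Or.inr ht))

/-! ### Moving a term across a letter -/

namespace PosTerm

variable {Γ : Type*}

/-- The innermost function symbol of a term together with the term that remains after removing
it; `none` for `cur`. The symbol is encoded by its direction (`true` for `suc` and `suc_A`,
`false` for `pred` and `pred_A`) and its set of letters, where `suc` and `pred` are treated as
`suc_Γ` and `pred_Γ`. -/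
def peel : PosTerm Γ → Option ((Bool × Set Γ) × PosTerm Γ)
  | cur => none
  | suc t => some <| match t.peel with
    | none => ((true, Set.univ), cur)
    | some (x, s) => (x, suc s)
  | pred t => some <| match t.peel with
    | none => ((false, Set.univ), cur)
    | some (x, s) => (x, pred s)
  | sucIn A hA t => some <| match t.peel with
    | none => ((true, A), cur)
    | some (x, s) => (x, sucIn A hA s)
  | predIn A hA t => some <| match t.peel with
    | none => ((false, A), cur)
    | some (x, s) => (x, predIn A hA s)

theorem peel_eq_none {t : PosTerm Γ} : t.peel = none ↔ t = cur := by
  cases t <;> simp [peel]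

theorem depth_of_peel {t s : PosTerm Γ} {x : Bool × Set Γ} (h : t.peel = some (x, s)) :
    t.depth = s.depth + 1 := by
  induction t generalizing s with
  | cur => simp [peel] at h
  | suc t ih | pred t ih | sucIn A hA t ih | predIn A hA t ih =>
    rcases h' : t.peel with _ | ⟨y, s'⟩
    · rw [peel, h'] at h
      rw [peel_eq_none.1 h']
      simp only [Option.some.injEq, Prod.mk.injEq] at h
      simp [depth, ← h.2]
    · rw [peel, h'] at h
      simp only [Option.some.injEq, Prod.mk.injEq] at h
      obtain ⟨rfl, rfl⟩ := h
      simp [depth, ih h']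

/-- Removing the innermost function symbol is an instance of the replacement of a subterm by
`cur`, so that `terms` is closed under it. The subterm has a single function symbol. -/
theorem exists_replace_of_peel {t s : PosTerm Γ} {x : Bool × Set Γ} (h : t.peel = some (x, s)) :
    ∃ t' ∈ t.sub, t'.depth = 1 ∧ t.replace t' cur = s := by
  induction t generalizing s with
  | cur => simp [peel] at h
  | suc t ih | pred t ih | sucIn A hA t ih | predIn A hA t ih =>
    rcases h' : t.peel with _ | ⟨y, s'⟩
    · rw [peel, h'] at h
      obtain rfl := peel_eq_none.1 h'
      simp only [Option.some.injEq, Prod.mk.injEq] at h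
      refine ⟨_, Or.inl rfl, rfl, ?_⟩
      rw [replace, if_pos rfl, ← h.2]
    · rw [peel, h'] at h
      simp only [Option.some.injEq, Prod.mk.injEq] at h
      obtain ⟨rfl, rfl⟩ := h
      obtain ⟨t', ht', hd, hr⟩ := ih h'
      refine ⟨t', Or.inr ht', hd, ?_⟩
      rw [replace, if_neg, hr]
      -- The replaced subterm is not the whole term, which has at least two function symbols.
      rintro rfl
      have := depth_of_peel h'
      simp only [depth] at hd
      omega

variable {D : Type*} {α : DataPath D Γ}

/-- The relation between positions that a single function symbol, encoded as in `peel`, stands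
for. -/
def Jump (α : DataPath D Γ) : Bool × Set Γ → Fin (α.length + 1) → Fin (α.length + 1) → Prop
  | (true, A), i, j => ∃ l : Fin α.length, j = l.succ ∧ i ≤ l.castSucc ∧ α.letter l ∈ A ∧
      ∀ l' : Fin α.length, i ≤ l'.castSucc → l' < l → α.letter l' ∉ A
  | (false, A), i, j => ∃ l : Fin α.length, j = l.castSucc ∧ l.succ ≤ i ∧ α.letter l ∈ A ∧
      ∀ l' : Fin α.length, l'.succ ≤ i → l < l' → α.letter l' ∉ A

theorem jump_true_univ {i j : Fin (α.length + 1)} :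
    Jump α (true, Set.univ) i j ↔ (j : ℕ) = i + 1 := by
  constructor
  · rintro ⟨l, rfl, h, -, h'⟩
    by_contra hne
    have h1 : (i : ℕ) ≤ l := h
    have h2 : (i : ℕ) ≠ l := fun e => hne (by simp [e])
    exact h' ⟨i, by omega⟩ le_rfl (Fin.lt_def.2 (by simp only; omega)) trivial
  · intro h
    refine ⟨⟨i, by omega⟩, Fin.ext h, le_rfl, trivial, fun l' h1 h2 => ?_⟩
    have h1 : (i : ℕ) ≤ l' := h1
    have h2 : (l' : ℕ) < i := h2
    omega

theorem jump_false_univ {i j : Fin (α.length + 1)} :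
    Jump α (false, Set.univ) i j ↔ (j : ℕ) + 1 = i := by
  constructor
  · rintro ⟨l, rfl, h, -, h'⟩
    by_contra hne
    have h1 : (l : ℕ) + 1 ≤ i := h
    have h2 : (l : ℕ) + 1 ≠ i := hne
    have h3 := i.2
    exact h' ⟨(i : ℕ) - 1, by omega⟩ (Fin.le_def.2 (by simp only [Fin.succ_mk]; omega))
      (Fin.lt_def.2 (by simp only; omega)) trivial
  · intro h
    refine ⟨⟨j, by omega⟩, rfl, Fin.le_def.2 (by simp [h]), trivial, fun l' h1 h2 => ?_⟩
    have h1 : (l' : ℕ) + 1 ≤ i := h1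
    have h2 : (j : ℕ) < l' := h2
    omega

/-- Crossing a letter from left to right, a forward jump stops there or is continued. -/
theorem jump_castSucc {A : Set Γ} {l : Fin α.length} {j : Fin (α.length + 1)} :
    Jump α (true, A) l.castSucc j ↔
      (α.letter l ∈ A ∧ j = l.succ) ∨ (α.letter l ∉ A ∧ Jump α (true, A) l.succ j) := by
  constructor
  · rintro ⟨l', rfl, h1, h2, h3⟩
    rcases (Fin.castSucc_le_castSucc_iff.1 h1).eq_or_lt with rfl | h
    · exact Or.inl ⟨h2, rfl⟩
    · refine Or.inr ⟨h3 l le_rfl h, l', rfl, h, h2, fun m hm => h3 m ?_⟩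
      exact (Fin.castSucc_le_succ l).trans hm
  · rintro (⟨h, rfl⟩ | ⟨h, l', rfl, h1, h2, h3⟩)
    · exact ⟨l, rfl, le_rfl, h, fun m h1 h2 => absurd h2 (not_lt.2 h1)⟩
    · refine ⟨l', rfl, (Fin.castSucc_le_succ l).trans h1, h2, fun m hm hm' => ?_⟩
      rcases (Fin.castSucc_le_castSucc_iff.1 hm).eq_or_lt with rfl | hlt
      · exact h
      · exact h3 m hlt hm'

/-- Crossing a letter from right to left, a backward jump stops there or is continued. -/
theorem jump_succ {A : Set Γ} {l : Fin α.length} {j : Fin (α.length + 1)} :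
    Jump α (false, A) l.succ j ↔
      (α.letter l ∈ A ∧ j = l.castSucc) ∨ (α.letter l ∉ A ∧ Jump α (false, A) l.castSucc j) := by
  constructor
  · rintro ⟨l', rfl, h1, h2, h3⟩
    rcases (Fin.succ_le_succ_iff.1 h1).eq_or_lt with rfl | h
    · exact Or.inl ⟨h2, rfl⟩
    · refine Or.inr ⟨h3 l le_rfl h, l', rfl, h, h2, fun m hm => h3 m ?_⟩
      exact hm.trans (Fin.castSucc_le_succ l)
  · rintro (⟨h, rfl⟩ | ⟨h, l', rfl, h1, h2, h3⟩)
    · exact ⟨l, rfl, le_rfl, h, fun m h1 h2 => absurd h2 (not_lt.2 (Fin.succ_le_succ_iff.1 h1))⟩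
    · refine ⟨l', rfl, h1.trans (Fin.castSucc_le_succ l), h2, fun m hm hm' => ?_⟩
      rcases (Fin.succ_le_succ_iff.1 hm).eq_or_lt with rfl | hlt
      · exact h
      · exact h3 m hlt hm'

theorem not_jump_last {A : Set Γ} {j : Fin (α.length + 1)} :
    ¬ Jump α (true, A) (Fin.last _) j := by
  rintro ⟨l, -, h, -⟩
  exact absurd (Fin.castSucc_lt_last l) (not_lt.2 h)

theorem not_jump_zero {A : Set Γ} {j : Fin (α.length + 1)} : ¬ Jump α (false, A) 0 j := by
  rintro ⟨l, -, h, -⟩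
  exact absurd (Fin.succ_pos l) (not_lt.2 h)

theorem denotes_iff_of_peel {t s : PosTerm Γ} {x : Bool × Set Γ} (h : t.peel = some (x, s))
    {i j : Fin (α.length + 1)} :
    t.Denotes α i j ↔ ∃ m, Jump α x i m ∧ s.Denotes α m j := by
  induction t generalizing s j with
  | cur => simp [peel] at h
  | suc t ih | pred t ih | sucIn B hB t ih | predIn B hB t ih =>
    rcases h' : t.peel with _ | ⟨y, s'⟩
    · rw [peel, h'] at h
      obtain rfl := peel_eq_none.1 h'
      simp only [Option.some.injEq, Prod.mk.injEq] at h
      obtain ⟨rfl, rfl⟩ := h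
      simp only [Denotes, exists_eq_left, exists_eq_right']
      first
        | exact Iff.rfl
        | exact jump_true_univ.symm
        | exact jump_false_univ.symm
    · rw [peel, h'] at h
      simp only [Option.some.injEq, Prod.mk.injEq] at h
      obtain ⟨rfl, rfl⟩ := h
      simp only [Denotes, ih h']
      constructor
      · rintro ⟨m, ⟨m', h1, h2⟩, h3⟩
        exact ⟨m', h1, m, h2, h3⟩
      · rintro ⟨m', h1, m, h2, h3⟩
        exact ⟨m, ⟨m', h1, h2⟩, h3⟩

end PosTerm

open PosTerm Classical in
/-- `Link a t u`: whenever the letter `a` occurs between two consecutive data values, the local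
rules force the value of `t` at the first one to equal the value of `u` at the second one. -/
def Link {Γ : Type*} (a : Γ) (t u : PosTerm Γ) : Prop :=
  (∃ A s, t.peel = some ((true, A), s) ∧ u = if a ∈ A then s else t) ∨
    ∃ A s, u.peel = some ((false, A), s) ∧ t = if a ∈ A then s else u

/-- The innermost function symbol is `pred` or `pred_A`, so the term is undefined at the first
position of every data path. -/
def PosTerm.IsBackward {Γ : Type*} (t : PosTerm Γ) : Prop := ∃ A s, t.peel = some ((false, A), s)

/-- The innermost function symbol is `suc` or `suc_A`, so the term is undefined at the last
position of every data path. -/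
def PosTerm.IsForward {Γ : Type*} (t : PosTerm Γ) : Prop := ∃ A s, t.peel = some ((true, A), s)

section Local

open PosTerm

variable {D Γ : Type*} {α : DataPath D Γ}

theorem DataPath.value_cur (i : Fin (α.length + 1)) : α.value cur i = some (α.data i) :=
  value_of_denotes rfl

theorem DataPath.value_link {t u : PosTerm Γ} {l : Fin α.length} (h : Link (α.letter l) t u) :
    α.value t l.castSucc = α.value u l.succ := by
  apply value_congr
  intro j
  rcases h with ⟨A, s, h, rfl⟩ | ⟨A, s, h, rfl⟩
  · rw [denotes_iff_of_peel h]
    split_ifs with ha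
    · simp [jump_castSucc, ha]
    · simp [jump_castSucc, ha, denotes_iff_of_peel h]
  · rw [denotes_iff_of_peel h]
    split_ifs with ha
    · simp [jump_succ, ha]
    · simp [jump_succ, ha, denotes_iff_of_peel h]

theorem DataPath.value_zero {t : PosTerm Γ} (h : t.IsBackward) : α.value t 0 = none := by
  obtain ⟨A, s, h⟩ := h
  exact value_eq_none fun j => by simp [denotes_iff_of_peel h, not_jump_zero]

theorem DataPath.value_last {t : PosTerm Γ} (h : t.IsForward) :
    α.value t (Fin.last _) = none := by
  obtain ⟨A, s, h⟩ := h
  exact value_eq_none fun j => by simp [denotes_iff_of_peel h, not_jump_last]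

/-- The local rules have only one solution. The value of a term is traced back to that of a term
with fewer function symbols at a neighbouring position, or to that of the same term at a
neighbouring position, in the direction of its innermost symbol. -/
theorem DataPath.eq_value_of_local {S : Set (PosTerm Γ)}
    (hS : ∀ t ∈ S, ∀ x s, t.peel = some (x, s) → s ∈ S)
    {V : PosTerm Γ → Fin (α.length + 1) → Option D}
    (hcur : ∀ i, V cur i = some (α.data i))
    (hlink : ∀ l : Fin α.length, ∀ t ∈ S, ∀ u ∈ S, Link (α.letter l) t u →
      V t l.castSucc = V u l.succ)
    (hzero : ∀ t ∈ S, t.IsBackward → V t 0 = none)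
    (hlast : ∀ t ∈ S, t.IsForward → V t (Fin.last _) = none)
    {t : PosTerm Γ} (ht : t ∈ S) (i : Fin (α.length + 1)) : V t i = α.value t i := by
  induction hn : t.depth using Nat.strong_induction_on generalizing t i with
  | _ n ih =>
    subst hn
    rcases hp : t.peel with _ | ⟨⟨_ | _, A⟩, s⟩
    · rw [peel_eq_none.1 hp, hcur, value_cur]
    · have hs := hS t ht _ s hp
      have hd := depth_of_peel hp
      induction i using Fin.induction with
      | zero => rw [hzero t ht ⟨A, s, hp⟩, value_zero ⟨A, s, hp⟩]
      | succ l ihl =>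
        by_cases ha : α.letter l ∈ A
        · have hl : Link (α.letter l) s t := Or.inr ⟨A, s, hp, by rw [if_pos ha]⟩
          rw [← hlink l s hs t ht hl, ← value_link hl]
          exact ih _ (by omega) hs _ rfl
        · have hl : Link (α.letter l) t t := Or.inr ⟨A, s, hp, by rw [if_neg ha]⟩
          rw [← hlink l t ht t ht hl, ← value_link hl, ihl]
    · have hs := hS t ht _ s hp
      have hd := depth_of_peel hp
      induction i using Fin.reverseInduction with
      | last => rw [hlast t ht ⟨A, s, hp⟩, value_last ⟨A, s, hp⟩]
      | cast l ihl =>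
        by_cases ha : α.letter l ∈ A
        · have hl : Link (α.letter l) t s := Or.inl ⟨A, s, hp, by rw [if_pos ha]⟩
          rw [hlink l t ht s hs hl, value_link hl]
          exact ih _ (by omega) hs _ rfl
        · have hl : Link (α.letter l) t t := Or.inl ⟨A, s, hp, by rw [if_neg ha]⟩
          rw [hlink l t ht t ht hl, value_link hl, ihl]

end Local

/-! ### Runs of automata with guessing -/

namespace NRAG

variable {D Γ Qd Qw : Type*} {k : ℕ}

/-- Acceptance in terms of the transitions taken at the data values and of the register contents
`θ i` before the data value of index `i`. -/
theorem mem_language_iff {ℬ : NRAG Γ Qd Qw k} {α : DataPath D Γ} :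
    α ∈ ℬ.language D ↔ ∃ (τ : Fin (α.length + 1) → GuessTransition Qd Qw k)
      (θ : Fin (α.length + 2) → Fin k → Option D),
      θ 0 = (fun _ => none) ∧ (τ 0).source ∈ ℬ.init ∧ (τ (Fin.last _)).target ∈ ℬ.final ∧
      (∀ i, τ i ∈ ℬ.dataTrans ∧ Update (τ i) (θ i.castSucc) (α.data i) (θ i.succ)) ∧
      ∀ l : Fin α.length,
        ((τ l.castSucc).target, α.letter l, (τ l.succ).source) ∈ ℬ.wordTrans := by
  constructor
  · rintro ⟨q, hq, q', hq', θ', h⟩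
    -- Every step advances the position by one, so a reachable configuration at position `m` is
    -- reached by a sequence of configurations that is indexed by the positions up to `m`.
    have path : ∀ c, Relation.ReflTransGen (ℬ.Step α) ⟨Sum.inl q, 0, fun _ => none⟩ c →
        ∃ p : ℕ → Config D Qd Qw k, p 0 = ⟨Sum.inl q, 0, fun _ => none⟩ ∧ p c.pos = c ∧
          ∀ j < c.pos, ℬ.Step α (p j) (p (j + 1)) := by
      intro c hc
      induction hc with
      | refl => exact ⟨fun _ => _, rfl, rfl, fun j hj => absurd hj (Nat.not_lt_zero j)⟩
      | @tail b c _ hbc ih =>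
        obtain ⟨p, h0, hb, hp⟩ := ih
        have hpos : c.pos = b.pos + 1 := by cases hbc <;> rfl
        refine ⟨fun j => if j ≤ b.pos then p j else c, ?_, ?_, fun j hj => ?_⟩
        · simp [h0]
        · simp [hpos]
        · rcases (Nat.lt_succ_iff.1 (hpos ▸ hj)).eq_or_lt with rfl | hlt
          · simpa [hb] using hbc
          · simpa [hlt.le, Nat.succ_le_of_lt hlt] using hp j hlt
    obtain ⟨p, h0, hend, hp⟩ := path _ h
    simp only at hend hp
    have hpos : ∀ j ≤ 2 * α.length + 1, (p j).pos = j := by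
      intro j
      induction j with
      | zero => simp [h0]
      | succ j ih =>
        intro hj
        have hs := hp j (by omega)
        have : (p (j + 1)).pos = (p j).pos + 1 := by
          generalize p j = b at hs
          generalize p (j + 1) = c at hs
          cases hs <;> rfl
        rw [this, ih (by omega)]
    have hdata : ∀ i : Fin (α.length + 1), ∃ τ ∈ ℬ.dataTrans,
        (p (2 * i)).state = Sum.inl τ.source ∧ (p (2 * i + 1)).state = Sum.inr τ.target ∧
        Update τ (p (2 * i)).reg (α.data i) (p (2 * i + 1)).reg := by
      intro i
      have hs := hp (2 * i) (by omega)
      have hpi := hpos (2 * i) (by omega)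
      generalize p (2 * i) = b at hs hpi
      generalize p (2 * i + 1) = c at hs
      cases hs with
      | word l θ h => simp only at hpi; omega
      | data i' hτ h =>
        obtain rfl : i' = i := Fin.ext (by simp only at hpi; omega)
        exact ⟨_, hτ, rfl, rfl, h⟩
    have hword : ∀ l : Fin α.length, ∃ q q', (q, α.letter l, q') ∈ ℬ.wordTrans ∧
        (p (2 * l + 1)).state = Sum.inr q ∧ (p (2 * l + 2)).state = Sum.inl q' ∧
        (p (2 * l + 1)).reg = (p (2 * l + 2)).reg := by
      intro l
      have hs := hp (2 * l + 1) (by omega)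
      have hpi := hpos (2 * l + 1) (by omega)
      rw [show 2 * (l : ℕ) + 1 + 1 = 2 * l + 2 from rfl] at hs
      generalize p (2 * l + 1) = b at hs hpi
      generalize p (2 * l + 2) = c at hs
      cases hs with
      | data i' hτ h => simp only at hpi; omega
      | word l' θ h =>
        obtain rfl : l' = l := Fin.ext (by simp only at hpi; omega)
        exact ⟨_, _, h, rfl, rfl, rfl⟩
    choose τ hτ hsrc htgt hupd using hdata
    refine ⟨τ, Fin.snoc (fun i : Fin (α.length + 1) => (p (2 * i)).reg) θ', ?_, ?_, ?_, ?_, ?_⟩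
    · rw [← Fin.castSucc_zero, Fin.snoc_castSucc]
      simp [h0]
    · have := hsrc 0
      simp only [Fin.val_zero, mul_zero, h0, Sum.inl.injEq] at this
      exact this ▸ hq
    · have := htgt (Fin.last _)
      simp only [Fin.val_last, hend, Sum.inr.injEq] at this
      exact this ▸ hq'
    · intro i
      refine ⟨hτ i, ?_⟩
      rw [Fin.snoc_castSucc]
      convert hupd i using 1
      induction i using Fin.lastCases with
      | last => simp [hend]
      | cast l =>
        obtain ⟨_, _, _, _, _, h⟩ := hword l
        rw [Fin.succ_castSucc, Fin.snoc_castSucc]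
        simpa [mul_add] using h.symm
    · intro l
      obtain ⟨q, q', hqq, h1, h2, -⟩ := hword l
      have h3 := htgt l.castSucc
      have h4 := hsrc l.succ
      simp only [Fin.val_castSucc, h1, Sum.inr.injEq] at h3
      simp only [Fin.val_succ, mul_add, mul_one, h2, Sum.inl.injEq] at h4
      rwa [← h3, ← h4]
  · rintro ⟨τ, θ, h0, hinit, hfinal, hdata, hword⟩
    refine ⟨_, hinit, _, hfinal, θ (Fin.last _).succ, ?_⟩
    have reach : ∀ i : Fin (α.length + 1), Relation.ReflTransGen (ℬ.Step α)
        ⟨Sum.inl (τ 0).source, 0, fun _ => none⟩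
        ⟨Sum.inl (τ i).source, 2 * i, θ i.castSucc⟩ := by
      intro i
      induction i using Fin.induction with
      | zero => rw [Fin.castSucc_zero, h0]; exact .refl
      | succ l ih =>
        have h1 := Step.data l.castSucc (hdata l.castSucc).1 (hdata l.castSucc).2
        have h2 := Step.word l (θ l.castSucc.succ) (hword l)
        exact (ih.tail h1).tail h2
    exact (reach (Fin.last _)).tail (Step.data _ (hdata _).1 (hdata _).2)

end NRAG

/-! ### Building register constraints -/

namespace RegConstraint

variable {D : Type*} {k : ℕ} [NeZero k]

/-- A valid constraint. -/
def top : RegConstraint k :=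
  or (eq 0 (Fin.last k) (Fin.ne_of_lt (Fin.last_pos' (n := k))))
    (ne 0 (Fin.last k) (Fin.ne_of_lt (Fin.last_pos' (n := k))))

/-- An unsatisfiable constraint. -/
def bot : RegConstraint k :=
  and (eq 0 (Fin.last k) (Fin.ne_of_lt (Fin.last_pos' (n := k))))
    (ne 0 (Fin.last k) (Fin.ne_of_lt (Fin.last_pos' (n := k))))

/-- Equality of two registers that are known to be nonempty, allowing `i = j`. -/
def eq' (i j : Fin (k + 1)) : RegConstraint k := if h : i ≠ j then eq i j h else top

/-- Inequality of two registers that are known to be nonempty, allowing `i = j`. -/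
def ne' (i j : Fin (k + 1)) : RegConstraint k := if h : i ≠ j then ne i j h else bot

/-- The conjunction of the constraints `c x` with `x` in a finite type and `x ∈ s`. -/
noncomputable def all {ι : Type*} [Finite ι] (s : Set ι) (c : ι → RegConstraint k) :
    RegConstraint k :=
  (s.toFinite.toFinset.toList.map c).foldr and top

variable {θ : Fin k → Option D} {d : D}

theorem sat_top : (top : RegConstraint k).Sat θ d := em _

theorem not_sat_bot : ¬ (bot : RegConstraint k).Sat θ d := fun h => h.2 h.1

theorem sat_eq' {i j : Fin (k + 1)} {x y : D}
    (hi : (Fin.cons (some d) θ : Fin (k + 1) → Option D) i = some x)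
    (hj : (Fin.cons (some d) θ : Fin (k + 1) → Option D) j = some y) :
    (eq' i j).Sat θ d ↔ x = y := by
  unfold eq'
  split_ifs with h
  · simp only [Sat, hi, hj, Option.some.injEq, exists_eq_left']
    exact eq_comm
  · obtain rfl := not_not.1 h
    exact iff_of_true sat_top (Option.some.inj (hi.symm.trans hj))

theorem sat_ne' {i j : Fin (k + 1)} {x y : D}
    (hi : (Fin.cons (some d) θ : Fin (k + 1) → Option D) i = some x)
    (hj : (Fin.cons (some d) θ : Fin (k + 1) → Option D) j = some y) :
    (ne' i j).Sat θ d ↔ x ≠ y := by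
  unfold ne'
  split_ifs with h
  · simp only [Sat, hi, hj, Option.some.injEq, exists_eq_left']
    exact not_congr eq_comm
  · obtain rfl := not_not.1 h
    exact iff_of_false not_sat_bot fun h => h (Option.some.inj (hi.symm.trans hj))

theorem sat_all {ι : Type*} [Finite ι] {s : Set ι} {c : ι → RegConstraint k} :
    (all s c).Sat θ d ↔ ∀ x ∈ s, (c x).Sat θ d := by
  have key : ∀ l : List ι, ((l.map c).foldr and top).Sat θ d ↔ ∀ x ∈ l, (c x).Sat θ d := by
    intro l
    induction l with
    | nil => simp [sat_top]
    | cons x l ih => simp [Sat, ih]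
  simp [all, key]

end RegConstraint

/-! ### The simulating automaton -/

section Simulation

variable {Γ : Type*} {k : ℕ}

/-- The index, in a constraint with `k + k` registers, of the old content of register `x`. -/
def oldReg (x : Fin k) : Fin (k + k + 1) := (Fin.castAdd k x).succ

/-- The index, in a constraint with `k + k` registers, of the new content of register `x`. -/
def newReg (x : Fin k) : Fin (k + k + 1) := (Fin.natAdd k x).succ

theorem cons_append_oldReg {D : Type*} {θ θ' : Fin k → Option D} {d : D} (x : Fin k) :
    (Fin.cons (some d) (Fin.append θ θ') : Fin (k + k + 1) → Option D) (oldReg x) = θ x :=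
  Fin.append_left θ θ' x

theorem cons_append_newReg {D : Type*} {θ : Fin k → Option D} {d : D} (g : Fin k → D)
    (x : Fin k) : (Fin.cons (some d) (Fin.append θ fun i => some (g i)) :
      Fin (k + k + 1) → Option D) (newReg x) = some (g x) :=
  Fin.append_right θ (fun i => some (g i)) x

instance [NeZero k] : NeZero (k + k) := ⟨by have := NeZero.ne k; omega⟩

/-- The register that holds the value of `t`, where register `x` holds that of `tm x`. It is
meaningful only for terms in the range of `tm`. -/
noncomputable def regOf [NeZero k] (tm : Fin k → PosTerm Γ) : PosTerm Γ → Fin k :=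
  Function.invFun tm

open Classical in
/-- The translation of a rigid data constraint into a constraint on the new register contents,
where `f` is the set of the registers whose terms are defined. -/
noncomputable def RigidConstraint.toReg [NeZero k] (tm : Fin k → PosTerm Γ) (f : Set (Fin k)) :
    RigidConstraint Γ → RegConstraint (k + k)
  | eq t₁ t₂ => if regOf tm t₁ ∈ f ∧ regOf tm t₂ ∈ f then
      .eq' (newReg (regOf tm t₁)) (newReg (regOf tm t₂)) else .bot
  | ne t₁ t₂ => if regOf tm t₁ ∈ f ∧ regOf tm t₂ ∈ f then
      .ne' (newReg (regOf tm t₁)) (newReg (regOf tm t₂)) else .top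
  | or c₁ c₂ => .or (c₁.toReg tm f) (c₂.toReg tm f)
  | and c₁ c₂ => .and (c₁.toReg tm f) (c₂.toReg tm f)

open Classical in
/-- The partial assignment of values to terms that is given by the set `f` of defined terms and
the register contents `g`. -/
noncomputable def assigned {D : Type*} [NeZero k] (tm : Fin k → PosTerm Γ) (f : Set (Fin k))
    (g : Fin k → D) (t : PosTerm Γ) : Option D :=
  if regOf tm t ∈ f then some (g (regOf tm t)) else none

theorem regOf_tm [NeZero k] {tm : Fin k → PosTerm Γ} (hinj : Function.Injective tm)
    (x : Fin k) : regOf tm (tm x) = x :=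
  Function.leftInverse_invFun hinj x

theorem tm_regOf [NeZero k] {tm : Fin k → PosTerm Γ} {t : PosTerm Γ} (h : t ∈ Set.range tm) :
    tm (regOf tm t) = t :=
  Function.invFun_eq h

open Classical in
theorem assigned_tm {D : Type*} [NeZero k] {tm : Fin k → PosTerm Γ} (hinj : Function.Injective tm)
    (f : Set (Fin k)) (g : Fin k → D) (x : Fin k) :
    assigned tm f g (tm x) = if x ∈ f then some (g x) else none := by
  rw [assigned, regOf_tm hinj]

theorem RigidConstraint.sat_toReg {D : Type*} [NeZero k] {tm : Fin k → PosTerm Γ}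
    {f : Set (Fin k)} {θ : Fin k → Option D} {g : Fin k → D} {d : D} (c : RigidConstraint Γ) :
    (c.toReg tm f).Sat (Fin.append θ fun i => some (g i)) d ↔ c.Eval (assigned tm f g) := by
  induction c with
  | eq t₁ t₂ =>
    unfold toReg
    split_ifs with h
    · rw [RegConstraint.sat_eq' (cons_append_newReg g _) (cons_append_newReg g _)]
      simp [Eval, assigned, h, eq_comm]
    · refine iff_of_false RegConstraint.not_sat_bot ?_
      rintro ⟨x, h1, h2⟩
      simp only [assigned, Option.ite_none_right_eq_some] at h1 h2
      exact h ⟨h1.1, h2.1⟩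
  | ne t₁ t₂ =>
    unfold toReg
    split_ifs with h
    · rw [RegConstraint.sat_ne' (cons_append_newReg g _) (cons_append_newReg g _)]
      simp [Eval, assigned, h, eq_comm]
    · refine iff_of_true RegConstraint.sat_top ?_
      rintro ⟨x, h1, h2⟩
      simp only [assigned, Option.ite_none_right_eq_some] at h1 h2
      exact h ⟨h1.1, h2.1⟩
  | or c₁ c₂ h₁ h₂ => exact or_congr h₁ h₂
  | and c₁ c₂ h₁ h₂ => exact and_congr h₁ h₂

/-- What a prefix of a data path demands from the next register contents: a set of registers whose
terms have to be undefined, and a set of pairs `(x, y)` such that the term of `y` has to be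
defined, with the new content of `y` equal to the old content of `x`. -/
abbrev Demand (k : ℕ) := Set (Fin k) × Set (Fin k × Fin k)

/-- The demand at the first data value. -/
def Demand.start (tm : Fin k → PosTerm Γ) : Demand k := ({y | (tm y).IsBackward}, ∅)

/-- The demand after the letter `a`, if `f` is the set of defined terms before it. -/
def Demand.next (tm : Fin k → PosTerm Γ) (f : Set (Fin k)) (a : Γ) : Demand k :=
  ({y | ∃ x, Link a (tm x) (tm y) ∧ x ∉ f}, {p | Link a (tm p.1) (tm p.2) ∧ p.1 ∈ f})

/-- The set of defined terms `f` is compatible with the demand, and contains `cur`. -/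
def Demand.Admits [NeZero k] (tm : Fin k → PosTerm Γ) (o : Demand k) (f : Set (Fin k)) : Prop :=
  regOf tm .cur ∈ f ∧ (∀ y ∈ o.1, y ∉ f) ∧ ∀ p ∈ o.2, p.2 ∈ f

namespace NRRA

variable {Qd Qw Sd Sw : Type*} [NeZero k]

/-- The transition that simulates the data transition `δ`: all registers are guessed anew, subject
to the demand `o` and the constraint of `δ`, with `f` as the set of defined terms. -/
noncomputable def guessTransition (tm : Fin k → PosTerm Γ) (ed : Qd ≃ Sd) (ew : Qw ≃ Sw)
    (δ : Qd × RigidConstraint Γ × Qw) (o : Demand k) (f : Set (Fin k)) :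
    GuessTransition (Sd × Demand k) (Sw × Set (Fin k)) k where
  source := (ed δ.1, o)
  test := .top
  target := (ew δ.2.2, f)
  store := ∅
  guess := Set.univ
  guessTest := .and (.eq' (newReg (regOf tm .cur)) 0)
    (.and (.all o.2 fun p => .eq' (oldReg p.1) (newReg p.2)) (δ.2.1.toReg tm f))

/-- The automaton that guesses, at each data value, the values of all the terms `tm x`, and checks
that the guesses at neighbouring data values fit together. The bijections `ed` and `ew` only
rename the states of `𝒜`. -/
noncomputable def simulator (𝒜 : NRRA Γ Qd Qw) (tm : Fin k → PosTerm Γ) (ed : Qd ≃ Sd)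
    (ew : Qw ≃ Sw) : NRAG Γ (Sd × Demand k) (Sw × Set (Fin k)) k where
  wordTrans := {τ | (ew.symm τ.1.1, τ.2.1, ed.symm τ.2.2.1) ∈ 𝒜.wordTrans ∧
    τ.2.2.2 = .next tm τ.1.2 τ.2.1}
  dataTrans := (fun x : (Qd × RigidConstraint Γ × Qw) × Demand k × Set (Fin k) =>
      guessTransition tm ed ew x.1 x.2.1 x.2.2) ''
    {x | x.1 ∈ 𝒜.dataTrans ∧ x.2.1.Admits tm x.2.2}
  dataTrans_finite := ((𝒜.dataTrans_finite.prod Set.finite_univ).subset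
    fun _ hx => ⟨hx.1, trivial⟩).image _
  disjoint := by
    rintro _ ⟨x, -, rfl⟩
    exact Set.empty_disjoint _
  guessTest_registers := by
    rintro _ ⟨x, -, rfl⟩ i hi
    exact absurd trivial hi
  init := {s | ed.symm s.1 ∈ 𝒜.init ∧ s.2 = .start tm}
  final := {s | ew.symm s.1 ∈ 𝒜.final ∧ ∀ x ∈ s.2, ¬ (tm x).IsForward}

variable {D : Type*} {tm : Fin k → PosTerm Γ} {ed : Qd ≃ Sd} {ew : Qw ≃ Sw}

/-- The equality tests of `guessTransition` are meaningful only if the old registers that they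
mention are nonempty, which is the hypothesis `hθ`. -/
theorem update_guessTransition {δ : Qd × RigidConstraint Γ × Qw} {o : Demand k}
    {f : Set (Fin k)} {θ θ' : Fin k → Option D} {d : D}
    (hθ : ∀ p ∈ o.2, ∃ x, θ p.1 = some x) :
    NRAG.Update (guessTransition tm ed ew δ o f) θ d θ' ↔
      ∃ g : Fin k → D, θ' = (fun i => some (g i)) ∧ g (regOf tm .cur) = d ∧
        (∀ p ∈ o.2, θ p.1 = some (g p.2)) ∧ δ.2.1.Eval (assigned tm f g) := by
  have hall : ∀ g : Fin k → D,
      (guessTransition tm ed ew δ o f).guessTest.Sat (Fin.append θ fun i => some (g i)) d ↔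
        g (regOf tm .cur) = d ∧ (∀ p ∈ o.2, θ p.1 = some (g p.2)) ∧
          δ.2.1.Eval (assigned tm f g) := by
    intro g
    refine and_congr (RegConstraint.sat_eq' (cons_append_newReg g _) rfl) (and_congr ?_ (δ.2.1.sat_toReg))
    rw [RegConstraint.sat_all]
    refine forall₂_congr fun p hp => ?_
    obtain ⟨x, hx⟩ := hθ p hp
    rw [RegConstraint.sat_eq' (x := x) ((cons_append_oldReg _).trans hx) (cons_append_newReg g _), hx, Option.some.injEq]
  constructor
  · rintro ⟨-, g, hg, -, hθ', -⟩
    exact ⟨g, funext fun i => hθ' i trivial, (hall g).1 hg⟩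
  · rintro ⟨g, rfl, hg⟩
    exact ⟨RegConstraint.sat_top, g, (hall g).2 hg, fun i hi => hi.elim, fun i _ => rfl,
      fun i _ hi => absurd trivial hi⟩

/-- Runs of `𝒜` are simulated by guessing the actual values of all terms. -/
theorem language_subset_simulator (𝒜 : NRRA Γ Qd Qw) (hinj : Function.Injective tm)
    (hcur : .cur ∈ Set.range tm)
    (hsides : ∀ δ ∈ 𝒜.dataTrans, δ.2.1.sides ⊆ Set.range tm) :
    𝒜.language D ⊆ (𝒜.simulator tm ed ew).language D := by
  rintro α ⟨ρ, hρ⟩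
  let f : Fin (α.length + 1) → Set (Fin k) := fun i => {x | (α.value (tm x) i).isSome}
  -- Guessed contents cannot be empty, so registers of undefined terms get an arbitrary value.
  let g : Fin (α.length + 1) → Fin k → D := fun i x => (α.value (tm x) i).getD (α.data i)
  have hfg : ∀ i x, x ∈ f i → α.value (tm x) i = some (g i x) := fun i x hx => by
    obtain ⟨y, hy⟩ := Option.isSome_iff_exists.1 hx
    simp [g, hy]
  have hassigned : ∀ i, ∀ t ∈ Set.range tm, assigned tm (f i) (g i) t = α.value t i := by
    rintro i _ ⟨x, rfl⟩
    rw [assigned_tm hinj]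
    split_ifs with h
    · exact (hfg i x h).symm
    · exact (Option.not_isSome_iff_eq_none.1 h).symm
  have hcurf : ∀ i, regOf tm .cur ∈ f i := fun i => by
    simp [f, tm_regOf hcur, α.value_cur]
  have hgcur : ∀ i, g i (regOf tm .cur) = α.data i := fun i => by
    simp [g, tm_regOf hcur, α.value_cur]
  have heval : ∀ i, (ρ.constraint i).Eval (assigned tm (f i) (g i)) := fun i =>
    (RigidConstraint.eval_congr fun t ht => hassigned i t (hsides _ (ρ.data_step i) ht)).2
      ((ρ.constraint i).sat_iff_eval.1 (ρ.sat i))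
  let o : Fin (α.length + 1) → Demand k :=
    Fin.cases (.start tm) fun l => .next tm (f l.castSucc) (α.letter l)
  rw [NRAG.mem_language_iff]
  refine ⟨fun i => guessTransition tm ed ew
      (ρ.dataState i, ρ.constraint i, ρ.wordState i) (o i) (f i),
    Fin.cases (fun _ => none) fun i x => some (g i x), rfl, ?_, ?_, fun i => ⟨?_, ?_⟩, ?_⟩
  · exact ⟨by simpa [guessTransition] using ρ.start, rfl⟩
  · refine ⟨by simpa [guessTransition] using hρ, fun x hx hf => ?_⟩
    have : (α.value (tm x) (Fin.last _)).isSome := hx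
    simp [α.value_last hf] at this
  · refine ⟨(_, o i, f i), ⟨ρ.data_step i, hcurf i, ?_⟩, rfl⟩
    induction i using Fin.cases with
    | zero =>
      refine ⟨fun y hy hf => ?_, fun p hp => hp.elim⟩
      have h1 : (α.value (tm y) 0).isSome := hf
      simp [α.value_zero (t := tm y) hy] at h1
    | succ l =>
      refine ⟨?_, ?_⟩
      · rintro y ⟨x, hxy, hx⟩ hy
        exact hx (by simpa [f, α.value_link hxy] using hy)
      · rintro ⟨x, y⟩ ⟨hxy, hx⟩
        simpa [f, ← α.value_link hxy] using hx
  · induction i using Fin.cases with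
    | zero =>
      refine (update_guessTransition fun p (hp : p ∈ (∅ : Set _)) => hp.elim).2 ?_
      exact ⟨g 0, rfl, hgcur 0, fun p (hp : p ∈ (∅ : Set _)) => hp.elim, heval 0⟩
    | succ l =>
      rw [← Fin.succ_castSucc]
      change NRAG.Update (guessTransition tm ed ew _ (o l.succ) (f l.succ))
        (fun x => some (g l.castSucc x)) _ (fun x => some (g l.succ x))
      rw [update_guessTransition fun p _ => ⟨g l.castSucc p.1, rfl⟩]
      refine ⟨g l.succ, rfl, hgcur _, ?_, heval _⟩
      rintro ⟨x, y⟩ ⟨hxy, hx⟩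
      have hy : y ∈ f l.succ := by simpa [f, ← α.value_link hxy] using hx
      exact (hfg _ _ hx).symm.trans ((α.value_link hxy).trans (hfg _ _ hy))
  · intro l
    exact ⟨by simpa [guessTransition] using ρ.word_step l, rfl⟩

/-- In an accepting run of the simulator, the guessed values satisfy the local rules, hence are the
actual values of the terms. -/
theorem simulator_language_subset (𝒜 : NRRA Γ Qd Qw) (hinj : Function.Injective tm)
    (hpeel : ∀ t ∈ Set.range tm, ∀ x s, t.peel = some (x, s) → s ∈ Set.range tm)
    (hsides : ∀ δ ∈ 𝒜.dataTrans, δ.2.1.sides ⊆ Set.range tm) :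
    (𝒜.simulator tm ed ew).language D ⊆ 𝒜.language D := by
  intro α hα
  rw [NRAG.mem_language_iff] at hα
  obtain ⟨τ, θ, h0, hinit, hfinal, hdata, hword⟩ := hα
  have hτ : ∀ i, ∃ δ o f, δ ∈ 𝒜.dataTrans ∧ Demand.Admits tm o f ∧
      τ i = guessTransition tm ed ew δ o f := fun i => by
    obtain ⟨x, hx, h⟩ := (hdata i).1
    exact ⟨_, _, _, hx.1, hx.2, h.symm⟩
  choose δ o f hδ hadm hτ using hτ
  obtain ⟨hinit, ho0⟩ := hinit
  obtain ⟨hfinal, hflast⟩ := hfinal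
  simp only [hτ, guessTransition, Equiv.symm_apply_apply] at hinit ho0 hfinal hflast
  have hword' : ∀ l : Fin α.length,
      ((δ l.castSucc).2.2, α.letter l, (δ l.succ).1) ∈ 𝒜.wordTrans ∧
        o l.succ = .next tm (f l.castSucc) (α.letter l) := fun l => by
    simpa [hτ, guessTransition, simulator] using hword l
  have hθ : ∀ i : Fin (α.length + 1), ∃ g : Fin k → D, θ i.succ = fun x => some (g x) := by
    intro i
    obtain ⟨-, g, -, -, hg, -⟩ := (hdata i).2
    refine ⟨g, funext fun x => hg x ?_⟩
    rw [hτ]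
    trivial
  have hupd : ∀ i, ∃ g : Fin k → D, θ i.succ = (fun x => some (g x)) ∧
      g (regOf tm .cur) = α.data i ∧ (∀ p ∈ (o i).2, θ i.castSucc p.1 = some (g p.2)) ∧
        (δ i).2.1.Eval (assigned tm (f i) g) := by
    intro i
    have h := (hdata i).2
    rw [hτ] at h
    refine (update_guessTransition fun p hp => ?_).1 h
    induction i using Fin.cases with
    | zero => simp [ho0, Demand.start] at hp
    | succ l =>
      obtain ⟨g, hg⟩ := hθ l.castSucc
      exact ⟨g p.1, by rw [← Fin.succ_castSucc, hg]⟩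
  choose g hθg hgcur hold heval using hupd
  have hvalue : ∀ i, ∀ t ∈ Set.range tm, assigned tm (f i) (g i) t = α.value t i := by
    intro i t ht
    refine DataPath.eq_value_of_local (V := fun t i => assigned tm (f i) (g i) t) hpeel
      (fun i => ?_) ?_ ?_ ?_ ht i
    · simp [assigned, (hadm i).1, hgcur]
    · rintro l _ ⟨x, rfl⟩ _ ⟨y, rfl⟩ hl
      simp only [assigned_tm hinj]
      have hadm' := (hadm l.succ).2
      rw [(hword' l).2] at hadm'
      by_cases hx : x ∈ f l.castSucc
      · have hy : y ∈ f l.succ := hadm'.2 (x, y) ⟨hl, hx⟩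
        have h := hold l.succ (x, y) (by rw [(hword' l).2]; exact ⟨hl, hx⟩)
        rw [← Fin.succ_castSucc, hθg] at h
        rw [if_pos hx, if_pos hy]
        exact h
      · have hy : y ∉ f l.succ := hadm'.1 y ⟨x, hl, hx⟩
        rw [if_neg hx, if_neg hy]
    · rintro _ ⟨x, rfl⟩ hb
      have hx : x ∉ f 0 := (hadm 0).2.1 x (by rw [ho0]; exact hb)
      simp [assigned_tm hinj, hx]
    · rintro _ ⟨x, rfl⟩ hf
      have hx : x ∉ f (Fin.last _) := fun hx => hflast x hx hf
      simp [assigned_tm hinj, hx]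
  refine ⟨{ dataState := fun i => (δ i).1, constraint := fun i => (δ i).2.1,
            wordState := fun i => (δ i).2.2, start := hinit, data_step := hδ,
            sat := fun i => ?_, word_step := fun l => (hword' l).1 }, hfinal⟩
  rw [RigidConstraint.sat_iff_eval]
  exact (RigidConstraint.eval_congr fun t ht => hvalue i t (hsides _ (hδ i) ht)).1 (heval i)

end NRRA
end Simulation

end RegisterAutomata

/-! ### Size of the simulating automaton -/

theorem mainTheorem3 :
    ∃ p q r : Polynomial ℕ,
      ∀ {Γ Qd Qw : Type*} [Fintype Γ] [Fintype Qd] [Fintype Qw] (𝒜 : NRRA Γ Qd Qw),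
        ∃ (Qd' Qw' : Type) (_ : Fintype Qd') (_ : Fintype Qw') (k : ℕ) (ℬ : NRAG Γ Qd' Qw' k),
          (∀ (D : Type*) [Infinite D], ℬ.language D = 𝒜.language D) ∧
          Fintype.card Qd' + Fintype.card Qw' ≤
            p.eval (Fintype.card Qd + Fintype.card Qw) * 2 ^ q.eval 𝒜.terms.ncard ∧
          k ≤ r.eval 𝒜.terms.ncard := by
  classical
  refine ⟨.X, (.X + 1) + (.X + 1) * (.X + 1), .X + 1, fun {Γ Qd Qw} _ _ _ 𝒜 => ?_⟩
  -- `cur` is missing from `𝒜.terms` if there are no data transitions. Adding it provides at least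
  -- one register, without which there would be no constraints at all.
  let S : Set (PosTerm Γ) := insert .cur 𝒜.terms
  have hS : S.Finite := 𝒜.terms_finite.insert _
  have hk : S.ncard ≤ 𝒜.terms.ncard + 1 := Set.ncard_insert_le _ _
  generalize hkdef : S.ncard = k at hk
  have : NeZero k := ⟨hkdef ▸ (Set.ncard_pos hS).2 ⟨.cur, Or.inl rfl⟩ |>.ne'⟩
  have : Finite S := hS
  let e : S ≃ Fin k := Finite.equivFinOfCardEq hkdef
  let tm : Fin k → PosTerm Γ := fun x => e.symm x
  have hinj : Function.Injective tm := Subtype.val_injective.comp e.symm.injective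
  have hrange : Set.range tm = S := by
    ext t
    exact ⟨fun ⟨x, hx⟩ => hx ▸ (e.symm x).2, fun ht => ⟨e ⟨t, ht⟩, by simp [tm]⟩⟩
  have hcur : PosTerm.cur ∈ Set.range tm := hrange ▸ Or.inl rfl
  have hpeel : ∀ t ∈ Set.range tm, ∀ x s, t.peel = some (x, s) → s ∈ Set.range tm := by
    rw [hrange]
    rintro t (rfl | ht) x s h
    · simp [PosTerm.peel] at h
    · obtain ⟨t', ht', -, rfl⟩ := PosTerm.exists_replace_of_peel h
      exact Or.inr (.replace ht ht')
  have hsides : ∀ δ ∈ 𝒜.dataTrans, δ.2.1.sides ⊆ Set.range tm := fun δ hδ t ht =>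
    hrange ▸ Or.inr (.occurs hδ ht)
  refine ⟨_, _, inferInstance, inferInstance, k,
    𝒜.simulator tm (Fintype.equivFin Qd) (Fintype.equivFin Qw), fun D _ =>
      (𝒜.simulator_language_subset hinj hpeel hsides).antisymm
        (𝒜.language_subset_simulator hinj hcur hsides), ?_, by simpa using hk⟩
  simp only [Fintype.card_prod, Fintype.card_fin, Fintype.card_set, Polynomial.eval_X,
    Polynomial.eval_add, Polynomial.eval_mul, Polynomial.eval_one]
  rw [← pow_add, add_mul]
  gcongr
  · norm_num
  · norm_num
  · exact hk.trans (Nat.le_add_right _ _)
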